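/- The Musical Chairs game $MC(n,m)$ is played by $n$ players on $m$ chairs $1,\dots,m$ against a scheduler. Player $i$ is given an infinite word $\pi_i$ over the alphabet $[m]=\{1,\dots,m\}$ that is full, i.e. contains every letter. The scheduler chooses for each $i$ a starting index $k_i$, and player $i$ starts on chair $\pi_i[k_i]$. Two players are in conflict if they are on the same chair. In every round, as long as there is a conflict, the scheduler chooses an arbitrary nonempty set of players that are currently in conflict, and each of these moves from its current chair $\pi_i[k]$ to $\pi_i[k+1]$. The game terminates when no two players are in conflict. The words $\pi_1,\dots,\pi_n$ are a winning strategy if, for all starting indices and all choices of the scheduler, the game terminates after finitely many rounds. An $MC(n,m)$ winning system with $N$ words is a collection of $N\ge n$ full words on $[m]$, every $n$ of which are a winning strategy for $MC(n,m)$. A permutation of $[m]$ is regarded as the infinite word obtained by traversing it cyclically. Theorem. For every integer $d\ge 1$ there is a constant $c\ge 1$, depending only on $d$, such that the following hold with $N=n^d$. (1) For all integers $n\ge 1$ and $m\ge cn$ (in particular for $m=cn$) there is an $MC(n,m)$ winning system consisting of $N$ permutations of $[m]$. (2) Almost every choice of $N$ permutations of $[m]$ is such a system: the probability that $N$ independent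 uniformly random permutations of $[m]$ form an $MC(n,m)$ winning system tends to $1$ as $n\to\infty$, uniformly in $m\ge cn$. -/

import Mathlib

namespace MusicalChairs

/-- Every one of the `m` chairs occurs in the infinite word `w`. -/
def IsFull {m : ℕ} (w : ℕ → Fin m) : Prop :=
  Function.Surjective w

/-- The players follow the words `w` and player `i` is at position `p i` of its word. Player `i` is
in conflict if some other player occupies the same chair. -/
def InConflict {n m : ℕ} (w : Fin n → ℕ → Fin m) (p : Fin n → ℕ) (i : Fin n) : Prop :=
  ∃ j, j ≠ i ∧ w j (p j) = w i (p i)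

/-- The configuration `p` has no conflict, so the game is over and the team has won. -/
def IsTerminal {n m : ℕ} (w : Fin n → ℕ → Fin m) (p : Fin n → ℕ) : Prop :=
  ∀ i, ¬ InConflict w p i

/-- One round of the game: the scheduler picks a nonempty set `S` of players that are in conflict,
and exactly the players in `S` advance to the next letter of their word. -/
def Round {n m : ℕ} (w : Fin n → ℕ → Fin m) (p q : Fin n → ℕ) : Prop :=
  ∃ S : Finset (Fin n), S.Nonempty ∧ (∀ i ∈ S, InConflict w p i) ∧
    ∀ i, q i = if i ∈ S then p i + 1 else p i

/-- The `n` words `w` are a winning strategy for the `MC(n, m)` game: they are full and, whatever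
the initial positions `p 0` and whatever legal choice the scheduler makes at each round,
a configuration without conflicts is reached after finitely many rounds. -/
def IsWinningStrategy {n m : ℕ} (w : Fin n → ℕ → Fin m) : Prop :=
  (∀ i, IsFull (w i)) ∧
    ∀ p : ℕ → Fin n → ℕ, (∀ t, ¬ IsTerminal w (p t) → Round w (p t) (p (t + 1))) →
      ∃ T, IsTerminal w (p T)

/-- An `MC(n, m)` winning system with `N` words: `N ≥ n` full words on `m` letters, every `n` of
which (at distinct indices) are a winning strategy for the `MC(n, m)` game. -/
def IsWinningSystem (n : ℕ) {N m : ℕ} (w : Fin N → ℕ → Fin m) : Prop :=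
  n ≤ N ∧ (∀ i, IsFull (w i)) ∧
    ∀ e : Fin n ↪ Fin N, IsWinningStrategy fun i => w (e i)

/-- The infinite periodic word that arises when the permutation
`σ 0, σ 1, …, σ (m - 1)` of the `m` chairs is traversed cyclically. -/
def cyclicWord {m : ℕ} [NeZero m] (σ : Equiv.Perm (Fin m)) : ℕ → Fin m :=
  fun k => σ (Fin.ofNat m k)

/-- The `N` permutations `σ` of the `m` chairs, traversed cyclically,
are an `MC(n, m)` winning system. -/
def IsWinningPermSystem (n : ℕ) {N m : ℕ} [NeZero m] (σ : Fin N → Equiv.Perm (Fin m)) : Prop :=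
  IsWinningSystem n fun i => cyclicWord (σ i)

/-- The probability that `N` independent uniformly random permutations of the `m` chairs are
an `MC(n, m)` winning system. -/
noncomputable def winningProbability (n N m : ℕ) [NeZero m] : ℝ :=
  ({σ : Fin N → Equiv.Perm (Fin m) | IsWinningPermSystem n σ}.ncard : ℝ) /
    (Fintype.card (Fin N → Equiv.Perm (Fin m)) : ℝ)

end MusicalChairs

/-! A play that never ends forces improbable coincidences among the permutations. Cut it into phases
of about `16 * u` moves, where `u = m / 2 ^ 46` is at least `(d + 1) * n`. A player leaves a chair
only if another player sits there, so the letters left in a phase are matched within the phase: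
examined in a fixed order, about half of them repeat a letter examined earlier in that phase
(`sum_le_two_mul_card_repeats`). In random permutations a fresh letter hits one of at most `2 ^ 5 *
u` given ones with conditional probability at most `2 ^ (-40)` (`card_matching_mul_pow_le`), while
recording the move counts and the places of the repeats costs only `O(u)` bits per phase.

Recording the `n` players and their starting positions costs up to `(d + 1) * k * n` bits, with `k`
about `log m`. One phase need not pay for this, so `k` phases are taken together.

Letters are fresh only while a player has not wrapped around; the cutoff is position `M = m / 2`. In
`k` phases at most `k` players pass it. If the others make at least `4 * u` moves in every phase,
the repeats add up to `k * u`. Otherwise, in some phase the few heavy players make most moves;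
restarted at the beginning of that phase, they alone produce `2 * u` repeats, and naming them costs
only about `(d + 1) * k ^ 2` bits, which is at most `u` for large `m`. A union bound excludes both
cases. -/

namespace MusicalChairs
open Finset

/-! ### Cutting a play into phases -/

/-- A stretch of play with between `b` and `b + n` moves that takes the players from positions `u`
to positions `v`: every letter that is left is met by another player during the stretch. -/
structure IsPhase {n m : ℕ} (w : Fin n → ℕ → Fin m) (b : ℕ) (u v : Fin n → ℕ) : Prop where
  le : ∀ i, u i ≤ v i
  lower : b ≤ ∑ i, (v i - u i)
  upper : ∑ i, (v i - u i) ≤ b + n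
  conflict : ∀ i k, u i ≤ k → k < v i →
    ∃ j, j ≠ i ∧ ∃ k', u j ≤ k' ∧ k' ≤ v j ∧ w j k' = w i k

theorem Round.le {n m : ℕ} {w : Fin n → ℕ → Fin m} {p q : Fin n → ℕ} (h : Round w p q)
    (i : Fin n) : p i ≤ q i := by
  obtain ⟨S, -, -, hq⟩ := h
  rw [hq]
  split_ifs <;> omega

theorem Round.le_succ {n m : ℕ} {w : Fin n → ℕ → Fin m} {p q : Fin n → ℕ} (h : Round w p q)
    (i : Fin n) : q i ≤ p i + 1 := by
  obtain ⟨S, -, -, hq⟩ := h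
  rw [hq]
  split_ifs <;> omega

theorem Round.inConflict {n m : ℕ} {w : Fin n → ℕ → Fin m} {p q : Fin n → ℕ} (h : Round w p q)
    {i : Fin n} (hi : p i < q i) : InConflict w p i := by
  obtain ⟨S, -, hS, hq⟩ := h
  refine hS i ?_
  by_contra hn
  rw [hq, if_neg hn] at hi
  omega

theorem Round.sum_lt {n m : ℕ} {w : Fin n → ℕ → Fin m} {p q : Fin n → ℕ} (h : Round w p q) :
    ∑ i, p i < ∑ i, q i := by
  have hle := h.le
  obtain ⟨S, ⟨i, hi⟩, -, hq⟩ := h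
  refine sum_lt_sum (fun i _ => hle i) ⟨i, mem_univ _, ?_⟩
  rw [hq, if_pos hi]
  omega

theorem Round.sum_le {n m : ℕ} {w : Fin n → ℕ → Fin m} {p q : Fin n → ℕ} (h : Round w p q) :
    ∑ i, q i ≤ ∑ i, p i + n := by
  calc ∑ i, q i ≤ ∑ i, (p i + 1) := sum_le_sum fun i _ => h.le_succ i
    _ = _ := by simp [sum_add_distrib]

/-- The phase stops at the first time when `b` moves have been made. -/
theorem exists_isPhase {n m : ℕ} {w : Fin n → ℕ → Fin m} {p : ℕ → Fin n → ℕ}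
    (hp : ∀ t, Round w (p t) (p (t + 1))) (b t : ℕ) :
    ∃ t', IsPhase w b (p t) (p t') := by
  have hmono : ∀ i, Monotone fun t => p t i := fun i => monotone_nat_of_le_succ fun t => (hp t).le i
  have hsum : StrictMono fun t => ∑ i, p t i := strictMono_nat_of_lt_succ fun t => (hp t).sum_lt
  have hex : ∃ s, ∑ i, p t i + b ≤ ∑ i, p (t + s) i := by
    refine ⟨b, ?_⟩
    have : ∀ s, ∑ i, p t i + s ≤ ∑ i, p (t + s) i := by
      intro s
      induction s with
      | zero => simp
      | succ s ih => have := (hp (t + s)).sum_lt; rw [← add_assoc t]; omega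
    exact this b
  classical
  obtain ⟨s, hs, hmin⟩ : ∃ s, ∑ i, p t i + b ≤ ∑ i, p (t + s) i ∧
      ∀ r < s, ¬ ∑ i, p t i + b ≤ ∑ i, p (t + r) i :=
    ⟨Nat.find hex, Nat.find_spec hex, fun r hr => Nat.find_min hex hr⟩
  have hle : ∀ i, p t i ≤ p (t + s) i := fun i => hmono i (by omega)
  have hdiff : ∑ i, (p (t + s) i - p t i) + ∑ i, p t i = ∑ i, p (t + s) i := by
    rw [← sum_add_distrib]
    exact sum_congr rfl fun i _ => by have := hle i; omega
  refine ⟨t + s, hle, by omega, ?_, ?_⟩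
  -- Before the last round fewer than `b` moves were made, and one round adds at most `n`.
  · rcases s with _ | s
    · simp
    · have h1 := hmin s (by omega)
      have h2 := (hp (t + s)).sum_le
      rw [add_assoc] at h2
      omega
  · intro i k hk hk'
    -- Just before the first time when player `i` is beyond `k`, it sits exactly at `k` and is in
    -- conflict.
    have hex' : ∃ r, k < p (t + r) i := ⟨s, hk'⟩
    have hspec := Nat.find_spec hex'
    have hfmin := fun r => Nat.find_min hex' (m := r)
    have hfs : Nat.find hex' ≤ s := Nat.find_min' hex' hk'
    generalize Nat.find hex' = r at hspec hfmin hfs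
    rcases r with _ | r
    · simp at hspec; omega
    · have h1 := hfmin r (by omega)
      have h2 := (hp (t + r)).le_succ i
      rw [← add_assoc] at hspec
      obtain ⟨j, hj, hw⟩ := (hp (t + r)).inConflict (i := i) (by omega)
      refine ⟨j, hj, p (t + r) j, hmono j (by omega), hmono j (by omega), ?_⟩
      rw [hw]
      congr 1
      omega

theorem IsPhase.shift {n m : ℕ} {w : Fin n → ℕ → Fin m} {b : ℕ} {u v : Fin n → ℕ}
    (h : IsPhase w b u v) (a : Fin n → ℕ) (ha : ∀ i, a i ≤ u i) :
    IsPhase (fun i x => w i (a i + x)) b (fun i => u i - a i) (fun i => v i - a i) := by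
  have hd : ∀ i, v i - a i - (u i - a i) = v i - u i := fun i => by have := ha i; omega
  refine ⟨fun i => Nat.sub_le_sub_right (h.le i) _, ?_, ?_, fun i k hk hk' => ?_⟩
  · simp only [hd]; exact h.lower
  · simp only [hd]; exact h.upper
  · obtain ⟨j, hj, k', h1, h2, h3⟩ := h.conflict i (a i + k) (by omega) (by omega)
    have := ha j
    refine ⟨j, hj, k' - a j, by omega, by omega, ?_⟩
    rw [← h3]
    congr 1
    omega

/-- An infinite play splits into consecutive phases. -/
theorem exists_phase_chain {n m : ℕ} {w : Fin n → ℕ → Fin m} {p : ℕ → Fin n → ℕ}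
    (hp : ∀ t, Round w (p t) (p (t + 1))) (b : ℕ) :
    ∃ κ : ℕ → Fin n → ℕ, κ 0 = 0 ∧
      ∀ s, IsPhase (fun i x => w i (p 0 i + x)) b (κ s) (κ (s + 1)) := by
  choose f hf using exists_isPhase hp b
  have hmono : ∀ i, Monotone fun t => p t i := fun i => monotone_nat_of_le_succ fun t => (hp t).le i
  refine ⟨fun s i => p (f^[s] 0) i - p 0 i, by ext; simp, fun s => ?_⟩
  have := (hf (f^[s] 0)).shift (p 0) fun i => hmono i (Nat.zero_le _)
  simpa only [Function.iterate_succ_apply'] using this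

/-! ### Repeated letters within a phase -/

section Cells

variable {q m : ℕ} (M : ℕ) (u v : Fin q → ℕ)

/-- The positions that the players occupy while moving from `u` to `v`. -/
def cells : Finset (Σ _ : Fin q, ℕ) :=
  univ.sigma fun i => Icc (u i) (v i)

/-- The positions to which players move on the way from `u` to `v`, for the players
that do not exceed position `M`. -/
def heads : Finset (Σ _ : Fin q, ℕ) :=
  ({i | v i ≤ M} : Finset (Fin q)).sigma fun i => Ioc (u i) (v i)

/-- The positions whose letters are examined before the letter of the head `a`: those of players that
exceed `M`, the starting positions, and the lexicographically smaller ones. -/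
def targets (a : Σ _ : Fin q, ℕ) : Finset (Σ _ : Fin q, ℕ) :=
  (cells u v).filter fun c => M < v c.1 ∨ c.2 = u c.1 ∨ c.1 < a.1 ∨ (c.1 = a.1 ∧ c.2 < a.2)

/-- The heads whose letter is the letter of one of their targets. -/
def repeats (w : Fin q → ℕ → Fin m) : Finset (Σ _ : Fin q, ℕ) :=
  (heads M u v).filter fun a => ∃ c ∈ targets M u v a, w c.1 c.2 = w a.1 a.2

variable {u v}

theorem card_cells_le {s : ℕ} (hs : ∑ i, (v i - u i) ≤ s) : #(cells u v) ≤ s + q := by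
  rw [cells, card_sigma]
  calc ∑ i, #(Icc (u i) (v i)) ≤ ∑ i, ((v i - u i) + 1) :=
        sum_le_sum fun i _ => by rw [Nat.card_Icc]; omega
    _ ≤ s + q := by simpa [sum_add_distrib] using hs

theorem card_heads_le {s : ℕ} (hs : ∑ i, (v i - u i) ≤ s) : #(heads M u v) ≤ s := by
  rw [heads, card_sigma]
  simp only [Nat.card_Ioc]
  exact (sum_le_sum_of_subset (filter_subset _ _)).trans hs

/-- If each letter that is left by a player not exceeding `M` is either in `X` or met by another
player, then about half of these letters are repeats. -/
theorem sum_le_two_mul_card_repeats {w : Fin q → ℕ → Fin m} (X : Finset (Fin m))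
    (h : ∀ i, v i ≤ M → ∀ k, u i < k → k < v i →
      w i k ∈ X ∨ ∃ j, j ≠ i ∧ ∃ k', u j ≤ k' ∧ k' ≤ v j ∧ w j k' = w i k) :
    ∑ i with v i ≤ M, (v i - u i) ≤ 2 * #(repeats M u v w) + #X + q := by
  classical
  set I : Finset (Σ _ : Fin q, ℕ) :=
    ({i | v i ≤ M} : Finset (Fin q)).sigma fun i => Ioo (u i) (v i) with hI
  have hIcard : ∑ i with v i ≤ M, (v i - u i) ≤ #I + q := by
    rw [hI, card_sigma]
    calc ∑ i with v i ≤ M, (v i - u i) ≤ ∑ i with v i ≤ M, (#(Ioo (u i) (v i)) + 1) :=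
          sum_le_sum fun i _ => by rw [Nat.card_Ioo]; omega
      _ ≤ _ := by
        rw [sum_add_distrib]
        refine Nat.add_le_add_left ?_ _
        simpa using card_le_univ ({i | v i ≤ M} : Finset (Fin q))
  have hIh : I ⊆ heads M u v := by
    intro a ha
    simp only [hI, heads, mem_sigma, mem_Ioo, mem_Ioc] at ha ⊢
    exact ⟨ha.1, ha.2.1, ha.2.2.le⟩
  set R := repeats M u v w with hR
  set D := I \ R with hD
  have htar : ∀ a ∈ heads M u v, ∀ a' ∈ heads M u v,
      (a.1 < a'.1 ∨ (a.1 = a'.1 ∧ a.2 < a'.2)) → a ∈ targets M u v a' := by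
    intro a ha a' _ hlt
    simp only [heads, targets, cells, mem_sigma, mem_filter, mem_Ioc, mem_univ, true_and,
      mem_Icc] at ha ⊢
    exact ⟨⟨ha.2.1.le, ha.2.2⟩, Or.inr (Or.inr hlt)⟩
  -- Of two heads with equal letters, the later one is a repeat.
  have hinj : Set.InjOn (fun a : Σ _ : Fin q, ℕ => w a.1 a.2) D := by
    intro a ha a' ha' heq
    simp only [hD, coe_sdiff, Set.mem_sdiff, mem_coe] at ha ha'
    have key : ∀ a ∈ I, ∀ a' ∈ I, a' ∉ R → w a.1 a.2 = w a'.1 a'.2 →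
        ¬ (a.1 < a'.1 ∨ (a.1 = a'.1 ∧ a.2 < a'.2)) := fun a ha a' ha' hn heq hlt =>
      hn (mem_filter.2 ⟨hIh ha', a, htar a (hIh ha) a' (hIh ha') hlt, heq⟩)
    have h1 := key a ha.1 a' ha'.1 ha'.2 heq
    have h2 := key a' ha'.1 a ha.1 ha.2 heq.symm
    obtain ⟨i, k⟩ := a
    obtain ⟨i', k'⟩ := a'
    simp only at h1 h2
    obtain rfl : i = i' := by
      rcases lt_trichotomy i i' with h | h | h
      · exact absurd (Or.inl h) h1
      · exact h
      · exact absurd (Or.inl h) h2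
    obtain rfl : k = k' := by
      rcases lt_trichotomy k k' with h | h | h
      · exact absurd (Or.inr ⟨rfl, h⟩) h1
      · exact h
      · exact absurd (Or.inr ⟨rfl, h⟩) h2
    rfl
  -- The letter of a non-repeat outside `X` is met at a position that is not among its targets,
  -- hence at a later head, which is therefore a repeat.
  have hDcard : #D ≤ #X + #R := by
    rw [← card_image_of_injOn hinj]
    refine (card_le_card (t := X ∪ R.image fun a => w a.1 a.2) ?_).trans
      ((card_union_le _ _).trans (Nat.add_le_add_left card_image_le _))
    intro x hx
    obtain ⟨a, ha, rfl⟩ := mem_image.1 hx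
    rw [hD, mem_sdiff] at ha
    have haI := ha.1
    simp only [hI, mem_sigma, mem_filter, mem_univ, true_and, mem_Ioo] at haI
    rcases h a.1 haI.1 a.2 haI.2.1 haI.2.2 with h1 | ⟨j, hj, k', hk, hk', hw⟩
    · exact mem_union_left _ h1
    · refine mem_union_right _ (mem_image.2 ⟨⟨j, k'⟩, ?_, hw⟩)
      have hnt : (⟨j, k'⟩ : Σ _ : Fin q, ℕ) ∉ targets M u v a := fun hc =>
        ha.2 (mem_filter.2 ⟨hIh ha.1, _, hc, hw⟩)
      simp only [targets, cells, mem_filter, mem_sigma, mem_univ, true_and, mem_Icc, hk, hk',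
        not_or, not_lt, not_and, and_self] at hnt
      have hjh : (⟨j, k'⟩ : Σ _ : Fin q, ℕ) ∈ heads M u v := by
        simp only [heads, mem_sigma, mem_filter, mem_univ, true_and, mem_Ioc]
        exact ⟨hnt.1, lt_of_le_of_ne hk (Ne.symm hnt.2.1), hk'⟩
      refine mem_filter.2 ⟨hjh, a, htar a (hIh ha.1) _ hjh (Or.inl ?_), hw.symm⟩
      exact lt_of_le_of_ne hnt.2.2.1 hj.symm
  have : #I ≤ #D + #R := by
    rw [hD]
    have := card_sdiff_add_card I R
    have h2 := card_le_card (subset_union_left (s₁ := I) (s₂ := R))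
    omega
  omega

end Cells

/-! ### Probability of prescribed repeats -/

/-- For positions `hd j`, `j ∈ J`, examined in the order given by `ρ`, the probability that the
letter at each `hd j` is one of the letters at `T j` is at most `(L / (m - M)) ^ #J`, where `L`
bounds the size of the sets `T j` and at most `M` positions of each permutation are examined. -/
theorem card_matching_mul_pow_le {N m L M : ℕ} {α β : Type*} [LinearOrder β] (J : Finset α)
    (ρ : α → β) (hd : α → Fin N × Fin m) (T : α → Finset (Fin N × Fin m))
    (B : α → Finset (Fin m)) (hB : ∀ j ∈ J, #(B j) ≤ M) (hL : ∀ j ∈ J, #(T j) ≤ L)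
    (hself : ∀ j ∈ J, (hd j).2 ∉ B j)
    (hT : ∀ j ∈ J, ∀ j' ∈ J, ρ j' ≤ ρ j → ∀ c ∈ T j', c.1 = (hd j).1 → c.2 ∈ B j)
    (hh : ∀ j ∈ J, ∀ j' ∈ J, j' ≠ j → ρ j' ≤ ρ j → (hd j').1 = (hd j).1 → (hd j').2 ∈ B j) :
    #{σ : Fin N → Equiv.Perm (Fin m) |
        ∀ j ∈ J, ∃ c ∈ T j, σ c.1 c.2 = σ (hd j).1 (hd j).2} * (m - M) ^ #J ≤
      L ^ #J * Fintype.card (Fin N → Equiv.Perm (Fin m)) := by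
  classical
  induction J using Finset.induction_on_max_value ρ with
  | empty => simp
  | insert a s has hmax ih =>
    have ih' := ih (fun j hj => hB j (mem_insert_of_mem hj)) (fun j hj => hL j (mem_insert_of_mem hj))
      (fun j hj => hself j (mem_insert_of_mem hj))
      (fun j hj j' hj' => hT j (mem_insert_of_mem hj) j' (mem_insert_of_mem hj'))
      (fun j hj j' hj' => hh j (mem_insert_of_mem hj) j' (mem_insert_of_mem hj'))
    set S' : Finset (Fin N → Equiv.Perm (Fin m)) :=
      {σ | ∀ j ∈ insert a s, ∃ c ∈ T j, σ c.1 c.2 = σ (hd j).1 (hd j).2} with hS'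
    set S : Finset (Fin N → Equiv.Perm (Fin m)) :=
      {σ | ∀ j ∈ s, ∃ c ∈ T j, σ c.1 c.2 = σ (hd j).1 (hd j).2} with hS
    have ha := mem_insert_self a s
    obtain ⟨i, k, hik⟩ : ∃ i k, hd a = (i, k) := ⟨_, _, rfl⟩
    have hka : k ∉ B a := by have := hself a ha; rwa [hik] at this
    -- The last head is resampled: swapping its letter with that at any of the at least `m - M`
    -- positions `k'` outside `B a` leaves all other examined letters unchanged. Afterwards the
    -- matched letter sits at `k'`, so each resulting `τ` admits at most `L` values of `k'`.
    have key : #S' * (m - M) ≤ #S * L := by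
      have h1 : #S' * (m - M) ≤ #(S' ×ˢ (B a)ᶜ) := by
        rw [card_product]
        refine Nat.mul_le_mul_left _ ?_
        rw [card_compl, Fintype.card_fin]
        exact Nat.sub_le_sub_left (hB a ha) m
      let sw : (Fin N → Equiv.Perm (Fin m)) → Fin m → Fin N → Equiv.Perm (Fin m) :=
        fun σ k' => Function.update σ i ((Equiv.swap k k').trans (σ i))
      have hsw : ∀ σ k' (c : Fin N × Fin m), k' ∉ B a → (c.1 = i → c.2 ∈ B a) →
          sw σ k' c.1 c.2 = σ c.1 c.2 := by
        intro σ k' c hk' hc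
        by_cases h : c.1 = i
        · have hc2 := hc h
          simp only [sw, h, Function.update_self, Equiv.trans_apply]
          rw [Equiv.swap_apply_of_ne_of_ne]
          · rintro rfl; exact hka hc2
          · rintro rfl; exact hk' hc2
        · simp [sw, h]
      have hswsw : ∀ σ k', sw (sw σ k') k' = σ := by
        intro σ k'
        ext j x
        by_cases h : j = i
        · subst h
          simp [sw]
        · simp [sw, h]
      have hTa : ∀ j ∈ insert a s, ∀ c ∈ T j, c.1 = i → c.2 ∈ B a := by
        intro j hj c hc hci
        refine hT a ha j hj ?_ c hc (by rw [hik]; exact hci)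
        rcases mem_insert.1 hj with rfl | hj
        · exact le_rfl
        · exact hmax j hj
      have h2 : #(S' ×ˢ (B a)ᶜ) ≤
          #(S.sigma fun τ => ({k' | ∃ c ∈ T a, τ c.1 c.2 = τ i k'} : Finset (Fin m))) := by
        refine card_le_card_of_injOn (fun x => ⟨sw x.1 x.2, x.2⟩) ?_ ?_
        · rintro ⟨σ, k'⟩ hx
          simp only [hS', mem_coe, mem_product, mem_filter, mem_univ, true_and, mem_compl] at hx
          simp only [hS, mem_coe, mem_sigma, mem_filter, mem_univ, true_and]
          refine ⟨fun j hj => ?_, ?_⟩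
          · obtain ⟨c, hc, heq⟩ := hx.1 j (mem_insert_of_mem hj)
            refine ⟨c, hc, ?_⟩
            rw [hsw σ k' c hx.2 (hTa j (mem_insert_of_mem hj) c hc), hsw σ k' (hd j) hx.2, heq]
            intro hji
            refine hh a ha j (mem_insert_of_mem hj) ?_ (hmax j hj) (by rw [hik]; exact hji)
            rintro rfl
            exact has hj
          · obtain ⟨c, hc, heq⟩ := hx.1 a ha
            refine ⟨c, hc, ?_⟩
            rw [hsw σ k' c hx.2 (hTa a ha c hc), heq, hik]
            simp [sw]
        · rintro ⟨σ, k'⟩ - ⟨σ', k''⟩ - heq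
          simp only [Sigma.mk.injEq, heq_eq_eq] at heq
          obtain ⟨h3, rfl⟩ := heq
          have := congrArg (fun τ => sw τ k') h3
          simp only [hswsw] at this
          rw [this]
      have h3 : #(S.sigma fun τ => ({k' | ∃ c ∈ T a, τ c.1 c.2 = τ i k'} : Finset (Fin m))) ≤
          #S * L := by
        rw [card_sigma, ← smul_eq_mul]
        refine sum_le_card_nsmul _ _ _ fun τ _ => ?_
        refine (card_le_card_of_injOn (t := (T a).image fun c => τ c.1 c.2) (τ i) ?_
          (τ i).injective.injOn).trans (card_image_le.trans (hL a ha))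
        intro k' hk'
        simpa [eq_comm] using hk'
      exact h1.trans (h2.trans h3)
    rw [card_insert_of_notMem has]
    calc #S' * (m - M) ^ (#s + 1) = (#S' * (m - M)) * (m - M) ^ #s := by ring
      _ ≤ (#S * L) * (m - M) ^ #s := Nat.mul_le_mul_right _ key
      _ = L * (#S * (m - M) ^ #s) := by ring
      _ ≤ L * (L ^ #s * Fintype.card (Fin N → Equiv.Perm (Fin m))) := Nat.mul_le_mul_left _ ih'
      _ = _ := by ring

/-! ### Union bound over repetitive plays -/

/-- There are `q` of the permutations `σ`, started at `s`, and `P` stages of at most `l` moves each,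
ending at the positions `κ 1, …, κ P`, in which at least `r` repeats occur. -/
def IsRepetitive (q P M l r : ℕ) {N m : ℕ} [NeZero m] (σ : Fin N → Equiv.Perm (Fin m)) : Prop :=
  ∃ (e : Fin q ↪ Fin N) (s : Fin q → Fin m) (κ : ℕ → Fin q → ℕ), κ 0 = 0 ∧
    (∀ t i, κ t i ≤ κ (t + 1) i) ∧ (∀ t < P, ∑ i, (κ (t + 1) i - κ t i) ≤ l) ∧
    r ≤ ∑ t ∈ range P, #(repeats M (κ t) (κ (t + 1)) fun i x => cyclicWord (σ (e i)) (s i + x))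

theorem ofNat_add_inj {m : ℕ} [NeZero m] {a x y : ℕ} (hx : x < m) (hy : y < m)
    (h : Fin.ofNat m (a + x) = Fin.ofNat m (a + y)) : x = y := by
  have h1 : (a + x) % m = (a + y) % m := congrArg Fin.val h
  have h2 : x ≡ y [MOD m] := Nat.ModEq.add_left_cancel' a h1
  rwa [Nat.ModEq, Nat.mod_eq_of_lt hx, Nat.mod_eq_of_lt hy] at h2

/-- Heads are examined by stage, then player, then position. Whatever has been examined of a head's
own word then lies strictly before it, and since the head is at most `M < m` there is no wraparound.
-/
theorem card_repeats_superset_mul_pow_le {q P M l N m : ℕ} [NeZero m] (hM : M < m)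
    (e : Fin q ↪ Fin N) (s : Fin q → Fin m) {κ : ℕ → Fin q → ℕ}
    (hmono : ∀ t i, κ t i ≤ κ (t + 1) i) (hl : ∀ t < P, ∑ i, (κ (t + 1) i - κ t i) ≤ l)
    (J : Finset (Σ _ : ℕ, Σ _ : Fin q, ℕ))
    (hJ : J ⊆ (range P).sigma fun t => heads M (κ t) (κ (t + 1))) :
    #{σ : Fin N → Equiv.Perm (Fin m) | J ⊆ (range P).sigma fun t =>
        repeats M (κ t) (κ (t + 1)) fun i x => cyclicWord (σ (e i)) (s i + x)} * (m - M) ^ #J ≤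
      (l + q) ^ #J * Fintype.card (Fin N → Equiv.Perm (Fin m)) := by
  classical
  let f : (Σ _ : Fin q, ℕ) → Fin N × Fin m := fun c => (e c.1, Fin.ofNat m (s c.1 + c.2))
  have hκ : ∀ i, Monotone fun t => κ t i := fun i => monotone_nat_of_le_succ fun t => hmono t i
  have hJ' : ∀ j ∈ J, j.1 < P ∧ κ (j.1 + 1) j.2.1 ≤ M ∧ κ j.1 j.2.1 < j.2.2 ∧
      j.2.2 ≤ κ (j.1 + 1) j.2.1 := by
    intro j hj
    simpa [heads, and_assoc] using hJ hj
  have hB : ∀ (i : Fin q) {k k' : ℕ}, k' < k →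
      Fin.ofNat m (s i + k') ∈ (range k).image fun x => Fin.ofNat m (s i + x) :=
    fun i k k' h => mem_image_of_mem _ (mem_range.2 h)
  have hrank : ∀ j ∈ J, ∀ j' ∈ J, toLex (j'.1, toLex (j'.2.1, j'.2.2)) ≤
      toLex (j.1, toLex (j.2.1, j.2.2)) → j'.1 < j.1 ∨ (j'.1 = j.1 ∧ (j'.2.1 < j.2.1 ∨
        (j'.2.1 = j.2.1 ∧ j'.2.2 ≤ j.2.2))) := by
    intro j _ j' _ h
    simpa [Prod.Lex.le_iff] using h
  refine le_trans (Nat.mul_le_mul_right _ (card_le_card ?_))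
    (card_matching_mul_pow_le (M := M) (L := l + q) J
      (fun j => toLex (j.1, toLex (j.2.1, j.2.2))) (fun j => f j.2)
      (fun j => (targets M (κ j.1) (κ (j.1 + 1)) j.2).image f)
      (fun j => (range j.2.2).image fun x => Fin.ofNat m (s j.2.1 + x)) ?_ ?_ ?_ ?_ ?_)
  · intro σ hσ
    simp only [mem_filter, mem_univ, true_and] at hσ ⊢
    intro j hj
    have := hσ hj
    simp only [mem_sigma, repeats, mem_filter] at this
    obtain ⟨-, -, c, hc, heq⟩ := this
    exact ⟨f c, mem_image_of_mem _ hc, heq⟩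
  · intro j hj
    have := hJ' j hj
    refine card_image_le.trans ?_
    rw [card_range]
    omega
  · intro j hj
    exact card_image_le.trans ((card_le_card (filter_subset _ _)).trans
      (card_cells_le (hl j.1 (hJ' j hj).1)))
  · intro j hj hc
    obtain ⟨x, hx, heq⟩ := mem_image.1 hc
    have h1 := hJ' j hj
    have h2 := mem_range.1 hx
    have := ofNat_add_inj (by omega) (by omega) heq
    omega
  · intro j hj j' hj' hle c hc hci
    obtain ⟨⟨i, k⟩, hik, rfl⟩ := mem_image.1 hc
    clear hc
    obtain ⟨t, i', k'⟩ := j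
    obtain ⟨t', i'', k''⟩ := j'
    obtain rfl : i = i' := e.injective hci
    refine hB i ?_
    have h1 := hrank _ hj _ hj' hle
    have h2 := hJ' _ hj
    simp only [targets, cells, mem_filter, mem_sigma, mem_univ, true_and, mem_Icc] at hik h1 h2 ⊢
    -- In an earlier stage the player stayed at or before its present starting position. In the same
    -- stage a target is excluded from the player's later positions, because this player does not
    -- exceed `M`.
    rcases h1 with h1 | ⟨rfl, h1⟩
    · have := hκ i (show t' + 1 ≤ t from h1)
      simp only at this
      omega
    · rcases hik.2 with h | h | h | h
      · omega
      · omega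
      · rcases h1 with h1 | h1
        · exact absurd h (by simpa using h1.le)
        · exact absurd h1.1 h.ne'
      · rcases h1 with h1 | h1
        · exact absurd h.1 h1.ne'
        · omega
  · intro j hj j' hj' hne hle hi
    obtain ⟨t, i, k⟩ := j
    obtain ⟨t', i', k'⟩ := j'
    obtain rfl : i' = i := e.injective hi
    refine hB i' ?_
    have h1 := hrank _ hj _ hj' hle
    have h2 := hJ' _ hj
    have h3 := hJ' _ hj'
    simp only [lt_self_iff_false, false_or, true_and] at h1 h2 h3 ⊢
    rcases h1 with h1 | ⟨rfl, h1⟩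
    · have := hκ i' (show t' + 1 ≤ t from h1)
      simp only at this
      omega
    · exact lt_of_le_of_ne h1 fun h => hne (by rw [h])

/-- Weight `f` by `2 ^ (-∑ f i)`: each counted `f` weighs at least `2 ^ (-S)`, and the total weight
is a product of truncated geometric series. -/
theorem card_sum_le_le_two_pow {ι : Type*} [Fintype ι] [DecidableEq ι] (S : ℕ) :
    #{f : ι → Fin (S + 1) | ∑ i, (f i : ℕ) ≤ S} ≤ 2 ^ (S + Fintype.card ι) := by
  have hgeom : ∑ k : Fin (S + 1), (1 / 2 : ℝ) ^ (k : ℕ) ≤ 2 := by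
    rw [Fin.sum_univ_eq_sum_range (fun k => (1 / 2 : ℝ) ^ k)]
    exact (Summable.sum_le_tsum _ (fun _ _ => by positivity) summable_geometric_two).trans
      tsum_geometric_two.le
  have h1 : (#{f : ι → Fin (S + 1) | ∑ i, (f i : ℕ) ≤ S} : ℝ) * (1 / 2) ^ S ≤
      ∑ f : ι → Fin (S + 1), ∏ i, (1 / 2 : ℝ) ^ (f i : ℕ) := by
    rw [← nsmul_eq_mul]
    refine (card_nsmul_le_sum _ (fun f : ι → Fin (S + 1) => ∏ i, (1 / 2 : ℝ) ^ (f i : ℕ)) _ ?_).trans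
      (sum_le_sum_of_subset_of_nonneg (subset_univ _) fun _ _ _ => by positivity)
    intro f hf
    rw [prod_pow_eq_pow_sum]
    exact pow_le_pow_of_le_one (by norm_num) (by norm_num) (mem_filter.1 hf).2
  have h2 : ∑ f : ι → Fin (S + 1), ∏ i, (1 / 2 : ℝ) ^ (f i : ℕ) ≤ 2 ^ Fintype.card ι := by
    rw [← Fintype.prod_sum (fun (_ : ι) (k : Fin (S + 1)) => (1 / 2 : ℝ) ^ (k : ℕ))]
    refine (prod_le_prod (fun _ _ => sum_nonneg fun _ _ => by positivity)
      fun _ _ => hgeom).trans ?_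
    simp
  have h3 := h1.trans h2
  have h4 : (#{f : ι → Fin (S + 1) | ∑ i, (f i : ℕ) ≤ S} : ℝ) ≤ 2 ^ (S + Fintype.card ι) := by
    rw [one_div, inv_pow, ← div_eq_mul_inv, div_le_iff₀ (by positivity)] at h3
    rw [pow_add, mul_comm]
    exact h3
  exact_mod_cast h4

-- The factors count, in order, the players, their starting positions, the move counts and the sets
-- of heads that are repeats.
open Classical in
theorem card_isRepetitive_mul_pow_le {q P M l r N m : ℕ} [NeZero m] (hM : M < m) :
    #{σ : Fin N → Equiv.Perm (Fin m) | IsRepetitive q P M l r σ} * (m - M) ^ r ≤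
      N ^ q * m ^ q * 2 ^ (P * l + P * q) * 2 ^ (P * l) *
        ((l + q) ^ r * Fintype.card (Fin N → Equiv.Perm (Fin m))) := by
  -- Positions rebuilt from their increments; they agree with `κ` up to stage `P`, which suffices.
  let K : (Fin P × Fin q → Fin (P * l + 1)) → ℕ → Fin q → ℕ :=
    fun Δ t i => ∑ t' : Fin P with t'.val < t, (Δ (t', i) : ℕ)
  let DS : Finset (Fin P × Fin q → Fin (P * l + 1)) := {Δ | ∑ a, (Δ a : ℕ) ≤ P * l}
  have hDS : #DS ≤ 2 ^ (P * l + P * q) := by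
    have := card_sum_le_le_two_pow (ι := Fin P × Fin q) (P * l)
    simpa [DS] using this
  have hKmono : ∀ Δ t i, K Δ t i ≤ K Δ (t + 1) i := fun Δ t i =>
    sum_le_sum_of_subset fun t' ht' => by
      simp only [mem_filter, mem_univ, true_and] at ht' ⊢; omega
  let V : (Fin q ↪ Fin N) → (Fin q → Fin m) → (Fin P × Fin q → Fin (P * l + 1)) →
      Finset (Σ _ : ℕ, Σ _ : Fin q, ℕ) → Finset (Fin N → Equiv.Perm (Fin m)) :=
    fun e s Δ J => {σ | J ⊆ (range P).sigma fun t =>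
        repeats M (K Δ t) (K Δ (t + 1)) fun i x => cyclicWord (σ (e i)) (s i + x)}
  let DS' : Finset (Fin P × Fin q → Fin (P * l + 1)) :=
    DS.filter fun Δ => ∀ t < P, ∑ i, (K Δ (t + 1) i - K Δ t i) ≤ l
  let HS : (Fin P × Fin q → Fin (P * l + 1)) → Finset (Σ _ : ℕ, Σ _ : Fin q, ℕ) :=
    fun Δ => (range P).sigma fun t => heads M (K Δ t) (K Δ (t + 1))
  have hcover : ({σ | IsRepetitive q P M l r σ} : Finset (Fin N → Equiv.Perm (Fin m))) ⊆
      ((univ : Finset (Fin q ↪ Fin N)) ×ˢ (univ : Finset (Fin q → Fin m))).biUnion fun es =>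
        DS'.biUnion fun Δ => (powersetCard r (HS Δ)).biUnion fun J => V es.1 es.2 Δ J := by
    intro σ hσ
    obtain ⟨e, s, κ, h0, hmono, hl, hr⟩ := (mem_filter.1 hσ).2
    have hsum : ∑ t : Fin P, ∑ i, (κ (t.val + 1) i - κ t.val i) ≤ P * l :=
      (sum_le_card_nsmul _ _ l fun t _ => hl t.1 t.2).trans (by simp)
    have hlt : ∀ a : Fin P × Fin q, κ (a.1 + 1) a.2 - κ a.1 a.2 < P * l + 1 := by
      intro a
      have h1 := single_le_sum (f := fun i => κ (a.1 + 1) i - κ a.1 i)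
        (fun _ _ => Nat.zero_le _) (mem_univ a.2)
      have h2 := single_le_sum (f := fun t : Fin P => ∑ i, (κ (t.val + 1) i - κ t.val i))
        (fun _ _ => Nat.zero_le _) (mem_univ a.1)
      omega
    let Δ : Fin P × Fin q → Fin (P * l + 1) := fun a => ⟨κ (a.1 + 1) a.2 - κ a.1 a.2, hlt a⟩
    have hK : ∀ t ≤ P, K Δ t = κ t := by
      intro t
      induction t with
      | zero => intro _; rw [h0]; ext i; simp [K]
      | succ t ih =>
        intro ht
        ext i
        have h1 := congrFun (ih (by omega)) i
        have h2 : ({t' | t'.val < t + 1} : Finset (Fin P)) =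
            insert ⟨t, ht⟩ ({t' | t'.val < t} : Finset (Fin P)) := by
          ext x; simp [Fin.ext_iff]; omega
        have h3 := hmono t i
        simp only [K] at h1 ⊢
        rw [h2, sum_insert (by simp), h1]
        simp only [Δ]
        omega
    rw [← card_sigma] at hr
    obtain ⟨J, hJ, hJr⟩ := exists_subset_card_eq hr
    have hKsub : ∀ t ∈ range P, K Δ t = κ t ∧ K Δ (t + 1) = κ (t + 1) := fun t ht =>
      ⟨hK t (mem_range.1 ht).le, hK (t + 1) (mem_range.1 ht)⟩
    refine mem_biUnion.2 ⟨(e, s), by simp, mem_biUnion.2 ⟨Δ, ?_, mem_biUnion.2 ⟨J, ?_, ?_⟩⟩⟩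
    · refine mem_filter.2 ⟨mem_filter.2 ⟨mem_univ _, ?_⟩, fun t ht => ?_⟩
      · rw [Fintype.sum_prod_type]
        exact hsum
      · rw [hK t ht.le, hK (t + 1) ht]
        exact hl t ht
    · refine mem_powersetCard.2 ⟨fun j hj => ?_, hJr⟩
      have h1 := mem_sigma.1 (hJ hj)
      refine mem_sigma.2 ⟨h1.1, ?_⟩
      rw [(hKsub _ h1.1).1, (hKsub _ h1.1).2]
      exact (mem_filter.1 h1.2).1
    · refine mem_filter.2 ⟨mem_univ _, fun j hj => ?_⟩
      have h1 := mem_sigma.1 (hJ hj)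
      refine mem_sigma.2 ⟨h1.1, ?_⟩
      rw [(hKsub _ h1.1).1, (hKsub _ h1.1).2]
      exact h1.2
  set C := (l + q) ^ r * Fintype.card (Fin N → Equiv.Perm (Fin m)) with hC
  have hV : ∀ e s, ∀ Δ ∈ DS', ∀ J ∈ powersetCard r (HS Δ), #(V e s Δ J) * (m - M) ^ r ≤ C := by
    intro e s Δ hΔ J hJ
    obtain ⟨h1, h2⟩ := mem_powersetCard.1 hJ
    have := card_repeats_superset_mul_pow_le hM e s (hKmono Δ) (mem_filter.1 hΔ).2 J h1
    rwa [h2] at this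
  have hHS : ∀ Δ ∈ DS', #(powersetCard r (HS Δ)) ≤ 2 ^ (P * l) := by
    intro Δ hΔ
    refine (card_le_card (fun J hJ => mem_powerset.2 (mem_powersetCard.1 hJ).1)).trans ?_
    rw [card_powerset]
    refine Nat.pow_le_pow_right (by norm_num) ?_
    rw [card_sigma]
    refine (sum_le_card_nsmul _ _ l fun t ht =>
      card_heads_le _ ((mem_filter.1 hΔ).2 t (mem_range.1 ht))).trans (by simp)
  refine (Nat.mul_le_mul_right _ (card_le_card hcover)).trans ?_
  have step3 : ∀ e s, ∀ Δ ∈ DS',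
      #((powersetCard r (HS Δ)).biUnion fun J => V e s Δ J) * (m - M) ^ r ≤ 2 ^ (P * l) * C := by
    intro e s Δ hΔ
    refine (Nat.mul_le_mul_right _ card_biUnion_le).trans ?_
    rw [sum_mul]
    refine (sum_le_card_nsmul _ _ C fun J hJ => hV e s Δ hΔ J hJ).trans ?_
    exact Nat.mul_le_mul_right _ (hHS Δ hΔ)
  have step2 : ∀ e s, #(DS'.biUnion fun Δ => (powersetCard r (HS Δ)).biUnion fun J => V e s Δ J) *
      (m - M) ^ r ≤ 2 ^ (P * l + P * q) * (2 ^ (P * l) * C) := by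
    intro e s
    refine (Nat.mul_le_mul_right _ card_biUnion_le).trans ?_
    rw [sum_mul]
    refine (sum_le_card_nsmul _ _ _ fun Δ hΔ => step3 e s Δ hΔ).trans ?_
    exact Nat.mul_le_mul_right _ ((card_le_card (filter_subset _ _)).trans hDS)
  refine (Nat.mul_le_mul_right _ card_biUnion_le).trans ?_
  rw [sum_mul]
  refine (sum_le_card_nsmul _ _ _ fun es _ => step2 es.1 es.2).trans ?_
  have hes : #((univ : Finset (Fin q ↪ Fin N)) ×ˢ (univ : Finset (Fin q → Fin m))) ≤
      N ^ q * m ^ q := by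
    rw [card_product]
    refine Nat.mul_le_mul ?_ (by simp)
    rw [card_univ]
    exact (Fintype.card_le_of_injective (fun e : Fin q ↪ Fin N => (e : Fin q → Fin N))
      DFunLike.coe_injective).trans (by simp)
  calc _ ≤ N ^ q * m ^ q * (2 ^ (P * l + P * q) * (2 ^ (P * l) * C)) := by
        rw [smul_eq_mul]; exact Nat.mul_le_mul_right _ hes
    _ = _ := by ring

/-! ### Endless plays are repetitive -/

theorem cyclicWord_ofNat_add {m : ℕ} [NeZero m] (σ : Equiv.Perm (Fin m)) (a x : ℕ) :
    cyclicWord σ ((Fin.ofNat m a : Fin m) + x) = cyclicWord σ (a + x) := by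
  refine congrArg σ (Fin.ext ?_)
  simp [Fin.ofNat, Nat.add_mod]

theorem isFull_cyclicWord {m : ℕ} [NeZero m] (σ : Equiv.Perm (Fin m)) : IsFull (cyclicWord σ) := by
  intro x
  refine ⟨(σ.symm x).val, ?_⟩
  rw [cyclicWord, Fin.ofNat_val_eq_self, Equiv.apply_symm_apply]

/-- If most moves of a stretch of play are made by the few players `i` with `M < v i`, then the
words of these players alone are repetitive. -/
theorem isRepetitive_of_sum_lt {n N m u M : ℕ} [NeZero m] {σ : Fin N → Equiv.Perm (Fin m)}
    (hM : 17 * u ≤ M) (hn : n ≤ u) (e : Fin n ↪ Fin N) (a x y : Fin n → ℕ)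
    (hph : IsPhase (fun i k => cyclicWord (σ (e i)) (a i + k)) (16 * u) x y)
    (hheavy : #{i | M < y i} ≤ u) (hlt : ∑ i with y i ≤ M, (y i - x i) < 4 * u) :
    IsRepetitive #{i | M < y i} 1 M (17 * u) (2 * u) σ := by
  classical
  set w : Fin n → ℕ → Fin m := fun i k => cyclicWord (σ (e i)) (a i + k) with hw
  set H : Finset (Fin n) := {i | M < y i} with hH
  let f : Fin #H ↪ Fin n := (H.orderEmbOfFin rfl).toEmbedding
  have hf : ∀ i, f i ∈ H := fun i => H.orderEmbOfFin_mem rfl i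
  have hfs : ∀ j ∈ H, ∃ i, f i = j := by
    intro j hj
    have : j ∈ Set.range (H.orderEmbOfFin rfl) := by rw [range_orderEmbOfFin]; exact hj
    exact this
  have hsumf : ∀ g : Fin n → ℕ, ∑ i, g (f i) = ∑ j ∈ H, g j := by
    intro g
    rw [← sum_map univ f g]
    congr 1
    ext j
    simp only [mem_map, mem_univ, true_and]
    exact ⟨fun ⟨i, hi⟩ => hi ▸ hf i, hfs j⟩
  have hsplit : ∑ i with y i ≤ M, (y i - x i) + ∑ i ∈ H, (y i - x i) = ∑ i, (y i - x i) := by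
    have := sum_filter_add_sum_filter_not univ (fun i => y i ≤ M) (fun i => y i - x i)
    simpa [hH] using this
  have hlow := hph.lower
  have hup := hph.upper
  have htot : ∑ i, (y (f i) - x (f i)) = ∑ i ∈ H, (y i - x i) := hsumf fun i => y i - x i
  let z : Fin #H → ℕ := fun i => y (f i) - x (f i)
  have hz : ∀ i, z i ≤ M := by
    intro i
    have := single_le_sum (f := z) (fun _ _ => Nat.zero_le _) (mem_univ i)
    have h2 : ∑ i, z i = ∑ i ∈ H, (y i - x i) := htot
    omega
  let w' : Fin #H → ℕ → Fin m := fun i k => w (f i) (x (f i) + k)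
  let C : Finset (Σ _ : Fin n, ℕ) :=
    ({i | y i ≤ M} : Finset (Fin n)).sigma fun i => Icc (x i) (y i)
  let X : Finset (Fin m) := C.image fun c => w c.1 c.2
  -- Fewer than `4 * u` moves, plus one starting cell for each of at most `n ≤ u` players.
  have hC : #C ≤ 5 * u := by
    have h1 : #C ≤ ∑ i with y i ≤ M, ((y i - x i) + 1) := by
      rw [card_sigma]
      exact sum_le_sum fun i _ => by rw [Nat.card_Icc]; omega
    have h2 : #({i | y i ≤ M} : Finset (Fin n)) ≤ n := by
      simpa using card_le_univ ({i | y i ≤ M} : Finset (Fin n))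
    rw [sum_add_distrib, sum_const, smul_eq_mul, mul_one] at h1
    omega
  have hX : #X ≤ 5 * u := card_image_le.trans hC
  have hrep := sum_le_two_mul_card_repeats (M := M) (u := fun _ => 0) (v := z) (w := w') X ?_
  · have h1 : ∑ i with z i ≤ M, (z i - 0) = ∑ i ∈ H, (y i - x i) := by
      rw [filter_true_of_mem fun i _ => hz i]
      exact htot
    rw [h1] at hrep
    -- The heavy players make more than `12 * u` moves, and `#X + #H ≤ 6 * u`.
    have hR : 2 * u ≤ #(repeats M (fun _ => 0) z w') := by omega
    refine ⟨f.trans e, fun i => Fin.ofNat m (a (f i) + x (f i)),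
      fun t => if t = 0 then fun _ => 0 else z, rfl, ?_, ?_, ?_⟩
    · intro t i
      by_cases h : t = 0 <;> simp [h]
    · intro t ht
      obtain rfl : t = 0 := by omega
      have h2 : ∑ i, z i = ∑ i ∈ H, (y i - x i) := htot
      simp
      omega
    · simp only [sum_range_one, cyclicWord_ofNat_add]
      refine hR.trans (le_of_eq ?_)
      congr 2
      ext i k
      simp [w', hw, add_assoc]
  · intro i _ k _ hk
    have hxy := hph.le (f i)
    obtain ⟨j, hj, k', h1, h2, h3⟩ := hph.conflict (f i) (x (f i) + k) (by omega)
      (by simp only [z] at hk; omega)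
    by_cases hjH : M < y j
    · right
      obtain ⟨j', rfl⟩ := hfs j (by simp [hH, hjH])
      refine ⟨j', fun h => hj (by rw [h]), k' - x (f j'), Nat.zero_le _, ?_, ?_⟩
      · simp only [z]; omega
      · have : x (f j') + (k' - x (f j')) = k' := by omega
        simp only [w', this]
        exact h3
    · left
      refine mem_image.2 ⟨⟨j, k'⟩, ?_, h3⟩
      simp only [C, mem_sigma, mem_filter, mem_univ, true_and, mem_Icc]
      omega

/-- `hB` keeps the heavy players from dominating any phase; the light ones then yield `u` repeats in
each of `P` phases, against `hA`. -/
theorem isWinningStrategy_of_not_isRepetitive {n N m P u M : ℕ} [NeZero m]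
    {σ : Fin N → Equiv.Perm (Fin m)} (hu : 0 < u) (hM : 17 * u ≤ M) (hn : n ≤ u) (hP : P ≤ u)
    (hB : ∀ h ≤ P, ¬ IsRepetitive h 1 M (17 * u) (2 * u) σ)
    (hA : ¬ IsRepetitive n P M (17 * u) (P * u) σ) (e : Fin n ↪ Fin N) :
    IsWinningStrategy fun i => cyclicWord (σ (e i)) := by
  refine ⟨fun i => isFull_cyclicWord _, fun p hp => ?_⟩
  by_contra! hcon
  obtain ⟨κ, h0, hph⟩ := exists_phase_chain (fun t => hp t (hcon t)) (16 * u)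
  have hup : ∀ t, ∑ i, (κ (t + 1) i - κ t i) ≤ 17 * u := fun t => (hph t).upper.trans (by omega)
  have hsum : ∀ t, ∑ i, κ t i ≤ t * (17 * u) := by
    intro t
    induction t with
    | zero => simp [h0]
    | succ t ih =>
      have h1 : ∑ i, κ (t + 1) i = ∑ i, (κ (t + 1) i - κ t i) + ∑ i, κ t i := by
        rw [← sum_add_distrib]
        exact sum_congr rfl fun i _ => by have := (hph t).le i; omega
      have := hup t
      rw [h1, Nat.succ_mul]
      omega
  refine hA ⟨e, fun i => Fin.ofNat m (p 0 i), κ, h0, fun t => (hph t).le, fun t _ => hup t, ?_⟩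
  simp only [cyclicWord_ofNat_add]
  rw [← smul_eq_mul]
  refine le_trans (by rw [card_range]) (card_nsmul_le_sum (range P) _ u fun t ht => ?_)
  have htP := mem_range.1 ht
  -- Each such player has made more than `17 * u` moves, out of at most `(t + 1) * (17 * u)` in all.
  have hheavy : #{i | M < κ (t + 1) i} ≤ P := by
    have h1 : #{i | M < κ (t + 1) i} * (17 * u) ≤ ∑ i, κ (t + 1) i := by
      rw [← smul_eq_mul]
      refine (card_nsmul_le_sum _ (κ (t + 1)) _ fun i hi => ?_).trans
        (sum_le_sum_of_subset (filter_subset _ _))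
      have := (mem_filter.1 hi).2
      omega
    have h2 := h1.trans (hsum (t + 1))
    have h3 := Nat.le_of_mul_le_mul_right h2 (by omega)
    omega
  have hfresh : 4 * u ≤ ∑ i with κ (t + 1) i ≤ M, (κ (t + 1) i - κ t i) := by
    by_contra! hlt
    exact hB _ hheavy (isRepetitive_of_sum_lt hM hn e (p 0) _ _ (hph t) (hheavy.trans hP) hlt)
  -- This gives `4 * u ≤ 2 * #repeats + n`, and `n ≤ u`.
  have hrep := sum_le_two_mul_card_repeats (M := M) (u := κ t) (v := κ (t + 1))
    (w := fun i x => cyclicWord (σ (e i)) (p 0 i + x)) ∅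
    fun i _ k hk hk' => Or.inr ((hph t).conflict i k hk.le hk')
  rw [card_empty] at hrep
  omega

/-! ### Numerical estimates and conclusion -/

open Classical in
theorem card_isRepetitive_mul_two_pow_le {q P M l r N m u d k : ℕ} [NeZero m] (hM : M < m)
    (hu : 0 < u) (hmM : 2 ^ 45 * u ≤ m - M) (hl : l + q ≤ 2 ^ 5 * u) (hN : N ≤ 2 ^ (d * k))
    (hm : m ≤ 2 ^ k) :
    #{σ : Fin N → Equiv.Perm (Fin m) | IsRepetitive q P M l r σ} * 2 ^ (40 * r) ≤
      2 ^ ((d + 1) * k * q + (P * l + P * q) + P * l) *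
        Fintype.card (Fin N → Equiv.Perm (Fin m)) := by
  set A := #{σ : Fin N → Equiv.Perm (Fin m) | IsRepetitive q P M l r σ}
  set F := Fintype.card (Fin N → Equiv.Perm (Fin m))
  have h := card_isRepetitive_mul_pow_le (q := q) (P := P) (l := l) (r := r) (N := N) hM
  refine Nat.le_of_mul_le_mul_right (c := (2 ^ 5 * u) ^ r) ?_ (by positivity)
  calc A * 2 ^ (40 * r) * (2 ^ 5 * u) ^ r = A * (2 ^ 45 * u) ^ r := by
        rw [pow_mul, mul_assoc, ← mul_pow]
        congr 2
        ring
    _ ≤ A * (m - M) ^ r := Nat.mul_le_mul_left _ (Nat.pow_le_pow_left hmM r)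
    _ ≤ _ := h
    _ ≤ (2 ^ (d * k)) ^ q * (2 ^ k) ^ q * 2 ^ (P * l + P * q) * 2 ^ (P * l) *
          ((2 ^ 5 * u) ^ r * F) := by gcongr
    _ = _ := by
      rw [← pow_mul, ← pow_mul]
      ring

theorem exists_log_sq_le (d A : ℕ) : ∃ m₀ : ℕ, ∀ m, m₀ ≤ m →
    (d + 1) * (Nat.log 2 m + 1) ^ 2 + (Nat.log 2 m + 1) + A ≤ m / 2 ^ 46 := by
  have h := tendsto_pow_const_div_const_pow_of_one_lt 2 (one_lt_two (α := ℝ))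
  -- The exponent is 47, not 46, because `2 ^ (Nat.log 2 m + 1)` can be as large as `2 * m`.
  have hpos : (0 : ℝ) < 1 / ((d + 2 + A) * 2 ^ 47) := by positivity
  obtain ⟨k₀, hk₀⟩ := Filter.eventually_atTop.1 (h.eventually_le_const hpos)
  refine ⟨2 ^ k₀, fun m hm => ?_⟩
  have hm0 : m ≠ 0 := by have := Nat.two_pow_pos k₀; omega
  have hk : k₀ ≤ Nat.log 2 m := (Nat.le_log_iff_pow_le one_lt_two hm0).2 hm
  have h1 := hk₀ (Nat.log 2 m + 1) (by omega)
  have h2 : 2 ^ Nat.log 2 m ≤ m := Nat.pow_log_le_self 2 hm0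
  generalize Nat.log 2 m = k at h1 h2
  rw [div_le_div_iff₀ (by positivity) (by positivity), one_mul] at h1
  have h3 : (k + 1) ^ 2 * ((d + 2 + A) * 2 ^ 47) ≤ 2 ^ (k + 1) := by exact_mod_cast h1
  rw [Nat.le_div_iff_mul_le (by positivity)]
  refine le_trans ?_ h2
  have h4 : (d + 1) * (k + 1) ^ 2 + (k + 1) + A ≤ (d + 2 + A) * (k + 1) ^ 2 := by
    have h5 : k + 1 ≤ (k + 1) ^ 2 := Nat.le_self_pow two_ne_zero _
    have h6 : A ≤ A * (k + 1) ^ 2 := Nat.le_mul_of_pos_right _ (by positivity)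
    nlinarith
  have h7 := Nat.mul_le_mul_right (2 ^ 46) h4
  rw [pow_succ 2 k] at h3
  refine h7.trans ?_
  have h8 : (k + 1) ^ 2 * ((d + 2 + A) * 2 ^ 47) =
      ((d + 2 + A) * (k + 1) ^ 2 * 2 ^ 46) * 2 := by ring
  rw [h8] at h3
  exact Nat.le_of_mul_le_mul_right h3 two_pos

open Classical in
theorem card_not_isWinningPermSystem_mul_two_pow_le {d n m : ℕ} [NeZero m] (hd : 1 ≤ d)
    (hn : 1 ≤ n) (hnm : 2 ^ 46 * (d + 1) * n ≤ m)
    (hm : (d + 1) * (Nat.log 2 m + 1) ^ 2 + (Nat.log 2 m + 1) ≤ m / 2 ^ 46) :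
    #{σ : Fin (n ^ d) → Equiv.Perm (Fin m) | ¬ IsWinningPermSystem n σ} * 2 ^ (m / 2 ^ 46) ≤
      2 * Fintype.card (Fin (n ^ d) → Equiv.Perm (Fin m)) := by
  set F := Fintype.card (Fin (n ^ d) → Equiv.Perm (Fin m)) with hF
  have hmk : m ≤ 2 ^ (Nat.log 2 m + 1) := (Nat.lt_pow_succ_log_self one_lt_two m).le
  obtain ⟨k, hk⟩ : ∃ k, Nat.log 2 m + 1 = k := ⟨_, rfl⟩
  obtain ⟨u, hu⟩ : ∃ u, m / 2 ^ 46 = u := ⟨_, rfl⟩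
  have hk1 : 1 ≤ k := by omega
  have hdn : (d + 1) * n ≤ u := by
    rw [← hu, Nat.le_div_iff_mul_le (by positivity)]
    calc _ = 2 ^ 46 * (d + 1) * n := by ring
      _ ≤ m := hnm
  rw [hk] at hmk hm
  rw [hu] at hm ⊢
  have hnu : n ≤ u := le_trans (Nat.le_mul_of_pos_left _ (by omega)) hdn
  have hu0 : 0 < u := by omega
  have hku : k ≤ u := by omega
  have hum : 2 ^ 46 * u ≤ m := by rw [← hu]; exact Nat.mul_div_le _ _
  -- Half of each word may be read; the other half keeps at least `2 ^ 45 * u` positions for the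
  -- swaps.
  set M := m / 2 with hMdef
  have hMm : M < m := by omega
  have hmM : 2 ^ 45 * u ≤ m - M := by omega
  have hM17 : 17 * u ≤ M := by omega
  have hN : n ^ d ≤ 2 ^ (d * k) := by
    rw [mul_comm, pow_mul]
    exact Nat.pow_le_pow_left (by omega) d
  -- At most `36 * k * u` bits are paid and `40 * k * u` gained.
  have hA : #{σ : Fin (n ^ d) → Equiv.Perm (Fin m) | IsRepetitive n k M (17 * u) (k * u) σ} *
      2 ^ u ≤ F := by
    have h := card_isRepetitive_mul_two_pow_le (q := n) (P := k) (r := k * u) (l := 17 * u) hMm hu0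
      hmM (by omega) hN hmk
    have h1 : (d + 1) * k * n ≤ k * u := by
      calc _ = k * ((d + 1) * n) := by ring
        _ ≤ _ := Nat.mul_le_mul_left _ hdn
    have h2 : k * n ≤ k * u := Nat.mul_le_mul_left _ hnu
    have h3 : u ≤ k * u := Nat.le_mul_of_pos_left _ hk1
    have h4 : k * (17 * u) = 17 * (k * u) := by ring
    have h5 : (d + 1) * k * n + (k * (17 * u) + k * n) + k * (17 * u) ≤ 36 * (k * u) := by omega
    refine Nat.le_of_mul_le_mul_right (c := 2 ^ (36 * (k * u))) ?_ (by positivity)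
    rw [mul_assoc, ← pow_add, mul_comm F]
    refine le_trans (Nat.mul_le_mul_left _ (Nat.pow_le_pow_right two_pos ?_))
      (h.trans (Nat.mul_le_mul_right _ (Nat.pow_le_pow_right two_pos h5)))
    omega
  -- At most `36 * u` bits are paid and `80 * u` gained; the spare `2 ^ k` absorbs the `k + 1`
  -- values of `h`.
  have hB : ∀ h ≤ k, #{σ : Fin (n ^ d) → Equiv.Perm (Fin m) |
      IsRepetitive h 1 M (17 * u) (2 * u) σ} * 2 ^ (u + k) ≤ F := by
    intro h hh
    have hb := card_isRepetitive_mul_two_pow_le (q := h) (P := 1) (r := 2 * u) (l := 17 * u) hMm hu0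
      hmM (by omega) hN hmk
    have h1 : (d + 1) * k * h ≤ (d + 1) * k ^ 2 := by
      calc _ ≤ (d + 1) * k * k := Nat.mul_le_mul_left _ hh
        _ = _ := by ring
    have h5 : (d + 1) * k * h + (1 * (17 * u) + 1 * h) + 1 * (17 * u) ≤ 36 * u := by omega
    refine Nat.le_of_mul_le_mul_right (c := 2 ^ (36 * u)) ?_ (by positivity)
    rw [mul_assoc, ← pow_add, mul_comm F]
    refine le_trans (Nat.mul_le_mul_left _ (Nat.pow_le_pow_right two_pos ?_))
      (hb.trans (Nat.mul_le_mul_right _ (Nat.pow_le_pow_right two_pos h5)))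
    omega
  have hcover : ({σ | ¬ IsWinningPermSystem n σ} : Finset (Fin (n ^ d) → Equiv.Perm (Fin m))) ⊆
      ({σ | IsRepetitive n k M (17 * u) (k * u) σ} : Finset _) ∪
        (range (k + 1)).biUnion fun h => {σ | IsRepetitive h 1 M (17 * u) (2 * u) σ} := by
    intro σ hσ
    by_contra hcon
    simp only [mem_union, mem_filter, mem_univ, true_and, mem_biUnion, mem_range, not_or,
      not_exists, not_and] at hcon hσ
    exact hσ ⟨Nat.le_self_pow (by omega) n, fun i => isFull_cyclicWord _,
      isWinningStrategy_of_not_isRepetitive hu0 hM17 hnu hku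
        (fun h hh => hcon.2 h (by omega)) hcon.1⟩
  have hBsum : #((range (k + 1)).biUnion fun h => ({σ | IsRepetitive h 1 M (17 * u) (2 * u) σ} :
      Finset (Fin (n ^ d) → Equiv.Perm (Fin m)))) * 2 ^ (u + k) ≤ (k + 1) * F := by
    refine (Nat.mul_le_mul_right _ card_biUnion_le).trans ?_
    rw [sum_mul]
    refine (sum_le_card_nsmul _ _ F fun h hh => hB h (by have := mem_range.1 hh; omega)).trans ?_
    simp
  have hBsum' : #((range (k + 1)).biUnion fun h => ({σ | IsRepetitive h 1 M (17 * u) (2 * u) σ} :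
      Finset (Fin (n ^ d) → Equiv.Perm (Fin m)))) * 2 ^ u ≤ F := by
    refine Nat.le_of_mul_le_mul_right (c := 2 ^ k) ?_ (by positivity)
    rw [mul_assoc, ← pow_add, mul_comm F]
    exact hBsum.trans (Nat.mul_le_mul_right _ Nat.lt_two_pow_self)
  calc _ ≤ _ := Nat.mul_le_mul_right _ ((card_le_card hcover).trans (card_union_le _ _))
    _ ≤ 2 * F := by rw [add_mul]; omega

/-- For `m` large and `n` at most a small multiple of `m`, almost all choices of `n ^ d`
permutations are winning systems. -/
theorem exists_one_sub_le_winningProbability {d : ℕ} (hd : 1 ≤ d) {ε : ℝ} (hε : 0 < ε) :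
    ∃ m₀ : ℕ, ∀ (n m : ℕ) [NeZero m], 1 ≤ n → m₀ ≤ m → 2 ^ 46 * (d + 1) * n ≤ m →
      1 - ε ≤ winningProbability n (n ^ d) m := by
  classical
  obtain ⟨A, hA⟩ := exists_pow_lt_of_lt_one (half_pos hε) (by norm_num : (1 / 2 : ℝ) < 1)
  obtain ⟨m₀, hm₀⟩ := exists_log_sq_le d A
  refine ⟨m₀, fun n m _ hn hm hnm => ?_⟩
  have h0 := hm₀ m hm
  have h := card_not_isWinningPermSystem_mul_two_pow_le hd hn hnm (by omega)
  have hAu : A ≤ m / 2 ^ 46 := by omega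
  set u := m / 2 ^ 46
  set F := Fintype.card (Fin (n ^ d) → Equiv.Perm (Fin m)) with hF
  have hF0 : (0 : ℝ) < F := by exact_mod_cast Fintype.card_pos
  set b := #{σ : Fin (n ^ d) → Equiv.Perm (Fin m) | ¬ IsWinningPermSystem n σ}
  have hg : {σ : Fin (n ^ d) → Equiv.Perm (Fin m) | IsWinningPermSystem n σ}.ncard + b = F := by
    have := card_filter_add_card_filter_not (s := (univ : Finset (Fin (n ^ d) → Equiv.Perm (Fin m))))
      (fun σ => IsWinningPermSystem n σ)
    rw [hF, ← card_univ, ← this, Set.ncard_eq_toFinset_card', Set.toFinset_ofPred]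
  have hg' : ({σ : Fin (n ^ d) → Equiv.Perm (Fin m) | IsWinningPermSystem n σ}.ncard : ℝ) =
      F - b := by
    rw [← hg]; push_cast; ring
  rw [winningProbability, hg', le_div_iff₀ hF0]
  have h1 : (b : ℝ) * 2 ^ u ≤ 2 * F := by exact_mod_cast h
  have h2 : (1 / 2 : ℝ) ^ u < ε / 2 :=
    (pow_le_pow_of_le_one (by norm_num) (by norm_num) hAu).trans_lt hA
  have h3 : (b : ℝ) ≤ 2 * F * (1 / 2) ^ u := by
    rw [one_div, inv_pow, ← div_eq_mul_inv, le_div_iff₀ (by positivity)]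
    exact h1
  nlinarith

end MusicalChairs

theorem theorem3 (d : ℕ) (hd : 1 ≤ d) :
    ∃ c : ℕ, 1 ≤ c ∧
      (∀ (n m : ℕ) [NeZero m], 1 ≤ n → c * n ≤ m →
        ∃ σ : Fin (n ^ d) → Equiv.Perm (Fin m), MusicalChairs.IsWinningPermSystem n σ) ∧
      (∀ ε : ℝ, 0 < ε → ∃ n₀ : ℕ, ∀ (n m : ℕ) [NeZero m], 1 ≤ n → n₀ ≤ n → c * n ≤ m →
        1 - ε ≤ MusicalChairs.winningProbability n (n ^ d) m) := by
  obtain ⟨m₁, hm₁⟩ := MusicalChairs.exists_one_sub_le_winningProbability hd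
    (by norm_num : (0 : ℝ) < 1 / 2)
  have hle : ∀ {n m : ℕ}, (2 ^ 46 * (d + 1) + m₁) * n ≤ m →
      2 ^ 46 * (d + 1) * n ≤ m ∧ m₁ * n ≤ m := by
    intro n m h
    rw [add_mul] at h
    omega
  -- The summand `m₁` forces `m ≥ m₁` for every `n ≥ 1`, so existence has no small exceptions.
  refine ⟨2 ^ 46 * (d + 1) + m₁, by omega, fun n m _ hn h => ?_, fun ε hε => ?_⟩
  · have h1 := hm₁ n m hn ((Nat.le_mul_of_pos_right _ hn).trans (hle h).2) (hle h).1
    by_contra! hcon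
    rw [MusicalChairs.winningProbability] at h1
    simp only [hcon, Set.ofPred_false, Set.ncard_empty] at h1
    norm_num at h1
  · obtain ⟨m₀, hm₀⟩ := MusicalChairs.exists_one_sub_le_winningProbability hd hε
    -- Since `m ≥ n`, the threshold for `m` serves as a threshold for `n`.
    refine ⟨m₀, fun n m _ hn hn₀ h => hm₀ n m hn (hn₀.trans ?_) (hle h).1⟩
    refine le_trans (Nat.le_mul_of_pos_left _ ?_) (hle h).1
    positivity
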